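/- Let $d\ge 0$. For $A\in\{\mathbb{Z},\mathbb{R}\}$ and $X\subset\mathbb{R}^d$, an *$A$-unimodular copy* of $X$ is a set $MX+b$ with $M\in\mathrm{GL}_d(\mathbb{Z})$ and $b\in A^d$. A *convex body* is a non-empty compact convex set $K\subset\mathbb{R}^d$ (not necessarily full-dimensional). It is *$A$-$X$-free* if its relative interior contains no $A$-unimodular copy of $X$ (the relative interior of a point being the point itself), and *inclusion-maximal $A$-$X$-free* if it is $A$-$X$-free and not properly contained in another $A$-$X$-free convex body. A *polytope* is the convex hull of a finite non-empty set of points. (1) Let $A\in\{\mathbb{Z},\mathbb{R}\}$ and let $X\subset\mathbb{R}^d$ be a full-dimensional polytope. Then every inclusion-maximal $A$-$X$-free convex body $K\subset\mathbb{R}^d$ is a polytope. (2) Let $A=\mathbb{Z}$ and let $X\subset\mathbb{R}^d$ be any bounded set whose affine hull is rational, i.e. is the affine hull of the points of $\mathbb{Q}^d$ that it contains (this holds, for instance, whenever $\mathrm{conv}(X)$ is full-dimensional, and whenever $X\subset\mathbb{Z}^d$). Then every inclusion-maximal $\mathbb{Z}$-$X$-free convex body $K\subset\mathbb{R}^d$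 is a polytope. -/

import Mathlib

namespace UnimodularFree

/-- The ring `ℤ`, as a subring of `ℝ`. -/
def intRing : Subring ℝ := (Int.castRingHom ℝ).range

/-- The affine map `x ↦ M x + b` of `ℝ^d`, for `M ∈ GL_d(ℤ)` and `b ∈ ℝ^d`. -/
noncomputable def affineMap {d : ℕ} (M : Matrix.GeneralLinearGroup (Fin d) ℤ)
    (b : EuclideanSpace ℝ (Fin d)) (x : EuclideanSpace ℝ (Fin d)) :
    EuclideanSpace ℝ (Fin d) :=
  WithLp.toLp 2 (fun i => (∑ j, ((M : Matrix (Fin d) (Fin d) ℤ) i j : ℝ) * x j) + b i)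

/-- `Y` is an `A`-unimodular copy of `X`: the image of `X` under `x ↦ M x + b` for some
`M ∈ GL_d(ℤ)` and some `b ∈ A^d`. -/
def IsUnimodularCopy {d : ℕ} (A : Subring ℝ) (X Y : Set (EuclideanSpace ℝ (Fin d))) : Prop :=
  ∃ (M : Matrix.GeneralLinearGroup (Fin d) ℤ) (b : EuclideanSpace ℝ (Fin d)),
    (∀ i, b i ∈ A) ∧ Y = affineMap M b '' X

/-- `K` is `A`-`X`-free: its relative interior contains no `A`-unimodular copy of `X`. The
`intrinsicInterior` is the interior relative to the affine span; that of a point is the point. -/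
def IsFree {d : ℕ} (A : Subring ℝ) (X K : Set (EuclideanSpace ℝ (Fin d))) : Prop :=
  ∀ Y, IsUnimodularCopy A X Y → ¬ Y ⊆ intrinsicInterior ℝ K

/-- Convex bodies: non-empty compact convex sets, not necessarily full-dimensional. -/
def IsConvexBody {d : ℕ} (K : Set (EuclideanSpace ℝ (Fin d))) : Prop :=
  K.Nonempty ∧ IsCompact K ∧ Convex ℝ K

/-- `K` is maximal with respect to inclusion among the `A`-`X`-free convex bodies. -/
def IsInclusionMaximalFree {d : ℕ} (A : Subring ℝ)
    (X K : Set (EuclideanSpace ℝ (Fin d))) : Prop :=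
  (IsConvexBody K ∧ IsFree A X K) ∧
    ∀ K', IsConvexBody K' → IsFree A X K' → K ⊆ K' → K' = K

/-- Polytopes: convex hulls of finitely many (and at least one) points. -/
def IsPolytope {d : ℕ} (P : Set (EuclideanSpace ℝ (Fin d))) : Prop :=
  ∃ V : Set (EuclideanSpace ℝ (Fin d)), V.Finite ∧ V.Nonempty ∧ P = convexHull ℝ V

/-- `X` is full-dimensional: its affine hull (equivalently, that of its convex hull) is `ℝ^d`. -/
def IsFullDimensional {d : ℕ} (X : Set (EuclideanSpace ℝ (Fin d))) : Prop :=
  affineSpan ℝ X = ⊤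

/-- The points of `ℝ^d` with rational coordinates. -/
def rationalPoints (d : ℕ) : Set (EuclideanSpace ℝ (Fin d)) :=
  {x | ∀ i, ∃ q : ℚ, x i = (q : ℝ)}

/-- The affine hull of `X` is a rational affine subspace, that is, it is the affine hull of the
rational points that it contains. -/
def HasRationalAffineHull {d : ℕ} (X : Set (EuclideanSpace ℝ (Fin d))) : Prop :=
  affineSpan ℝ (rationalPoints d ∩ (affineSpan ℝ X : Set (EuclideanSpace ℝ (Fin d))))
    = affineSpan ℝ X

end UnimodularFree

/-! Suppose first that finitely many halfspaces containing `K` cut off every copy inside a box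
around `K`, and that `K` has interior. Intersecting the halfspaces with the box gives a bounded
polyhedron containing `K` that is still free, so by maximality it equals `K`
(`IsInclusionMaximalFree.isPolytope`).

`K` has interior: if it lay in a hyperplane `f = c`, thickening it slightly to one side would
destroy freeness. This gives copies in a bounded region squeezed between `f = c` and `f = c +
1/(n+1)`. For integer translations only finitely many copies are available, so one recurs and has no
room. For real translations only finitely many matrices are, so one recurs and would flatten `X`
onto a hyperplane.

The halfspaces: over `ℤ`, one separating halfspace per copy. Over `ℝ` there are infinitely many
translates per matrix. There a single Hahn–Banach separation in the product of copies of the space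
indexed by the finite generating set `V` of `X` handles all translates at once
(`exists_halfspaces_of_translates`). -/

open Set Filter Topology

namespace UnimodularFree

/-! ### Polyhedra and separating halfspaces -/

section Polyhedra

variable {E : Type*} [NormedAddCommGroup E] [NormedSpace ℝ E]

/-- A point of the relative interior can be moved a little away from any point of the set. -/
theorem exists_pos_add_smul_sub_mem {s : Set E} {y w : E}
    (hy : y ∈ intrinsicInterior ℝ s) (hw : w ∈ s) : ∃ t : ℝ, 0 < t ∧ y + t • (y - w) ∈ s := by
  obtain ⟨z, hz, rfl⟩ := mem_intrinsicInterior.1 hy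
  have hmem : ∀ t : ℝ, (z : E) + t • ((z : E) - w) ∈ affineSpan ℝ s := fun t => by
    have := AffineSubspace.smul_vsub_vadd_mem (affineSpan ℝ s) t z.2
      (subset_affineSpan ℝ s hw) z.2
    simpa [add_comm] using this
  let γ : ℝ → affineSpan ℝ s := fun t => ⟨(z : E) + t • ((z : E) - w), hmem t⟩
  have hγ : Continuous γ := by
    apply Continuous.subtype_mk
    fun_prop
  have hγ0 : γ 0 = z := by
    apply Subtype.ext
    simp [γ]
  have hev : ∀ᶠ t in 𝓝 (0 : ℝ), γ t ∈ ((↑) ⁻¹' s : Set (affineSpan ℝ s)) := by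
    apply hγ.continuousAt.eventually_mem
    rw [hγ0]
    exact mem_interior_iff_mem_nhds.1 hz
  obtain ⟨t, ht, ht'⟩ := ((hev.filter_mono nhdsWithin_le_nhds).and
    (self_mem_nhdsWithin : ∀ᶠ t in 𝓝[>] (0 : ℝ), t ∈ Ioi 0)).exists
  exact ⟨t, ht', ht⟩

/-- If `f y = c`, moving from `y` slightly away from `w` stays in `s` but raises `f` above `c`. -/
theorem lt_of_mem_intrinsicInterior {s : Set E} {f : StrongDual ℝ E} {c : ℝ}
    (hs : ∀ x ∈ s, f x ≤ c) {y w : E} (hy : y ∈ intrinsicInterior ℝ s) (hw : w ∈ s)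
    (hwc : f w < c) : f y < c := by
  obtain ⟨t, ht, hmem⟩ := exists_pos_add_smul_sub_mem hy hw
  have h := hs _ hmem
  simp only [map_add, map_smul, map_sub, smul_eq_mul] at h
  by_contra! hcon
  nlinarith

theorem lt_of_mem_interior {s : Set E} {f : StrongDual ℝ E} (hf : f ≠ 0) {c : ℝ}
    (hs : ∀ x ∈ s, f x ≤ c) {y : E} (hy : y ∈ interior s) : f y < c := by
  have h : f '' interior s ⊆ interior (Iic c) :=
    interior_maximal (image_subset_iff.2 fun x hx => hs x (interior_subset hx))
      (f.isOpenMap_of_ne_zero hf _ isOpen_interior)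
  rw [interior_Iic] at h
  exact h (mem_image_of_mem f hy)

/-- The polyhedron cut out by the inequalities `f x ≤ c` with `(f, c) ∈ T`. -/
def polyhedron (T : Set (StrongDual ℝ E × ℝ)) : Set E := {x | ∀ p ∈ T, p.1 x ≤ p.2}

theorem convex_polyhedron (T : Set (StrongDual ℝ E × ℝ)) : Convex ℝ (polyhedron T) := by
  intro x hx y hy a b ha hb hab p hp
  simp only [map_add, map_smul, smul_eq_mul]
  calc a * p.1 x + b * p.1 y ≤ a * p.2 + b * p.2 := by gcongr <;> [exact hx p hp; exact hy p hp]
    _ = p.2 := by rw [← add_mul, hab, one_mul]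

theorem isClosed_polyhedron (T : Set (StrongDual ℝ E × ℝ)) : IsClosed (polyhedron T) := by
  simp only [polyhedron, ofPred_forall]
  exact isClosed_biInter fun p _ => isClosed_le p.1.continuous continuous_const

/-- Two extreme points of a polyhedron with the same active constraints coincide. -/
theorem eq_of_active_eq {T : Set (StrongDual ℝ E × ℝ)} (hT : T.Finite) {x y : E}
    (hx : x ∈ (polyhedron T).extremePoints ℝ) (hy : y ∈ polyhedron T)
    (hxy : ∀ p ∈ T, p.1 x = p.2 → p.1 y = p.2) : x = y := by
  -- Constraints active at `x` are constant along the line through `x` and `y`; the others survive a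
  -- short move. So `x` lies strictly between two points of the polyhedron.
  have hev : ∀ᶠ t in 𝓝[>] (0 : ℝ), ∀ p ∈ T, p.1 (x + t • (x - y)) ≤ p.2 := by
    rw [Filter.eventually_all_finite hT]
    intro p hp
    rcases (hx.1 p hp).eq_or_lt with h | h
    · refine Eventually.of_forall fun t => ?_
      simp [h, hxy p hp h]
    · have hc : ContinuousAt (fun t : ℝ => p.1 (x + t • (x - y))) 0 := by fun_prop
      exact ((hc.eventually_lt_const (by simpa using h)).filter_mono nhdsWithin_le_nhds).mono
        fun t ht => ht.le
  obtain ⟨t, ht, ht0⟩ := (hev.and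
    (self_mem_nhdsWithin : ∀ᶠ t in 𝓝[>] (0 : ℝ), t ∈ Ioi 0)).exists
  have ht0 : 0 < t := ht0
  refine ((mem_extremePoints.1 hx).2 _ ht y hy ?_).2.symm
  refine ⟨1 / (1 + t), t / (1 + t), by positivity, by positivity, by field_simp, ?_⟩
  have h1 : (1 + t) ≠ 0 := by positivity
  calc (1 / (1 + t)) • (x + t • (x - y)) + (t / (1 + t)) • y
      = (1 / (1 + t)) • ((1 + t) • x) := by rw [div_eq_mul_one_div t]; module
    _ = x := by rw [smul_smul, one_div_mul_cancel h1, one_smul]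

theorem finite_extremePoints_polyhedron {T : Set (StrongDual ℝ E × ℝ)} (hT : T.Finite) :
    ((polyhedron T).extremePoints ℝ).Finite := by
  refine Set.Finite.of_finite_image (f := fun x => {p ∈ T | p.1 x = p.2})
    (hT.finite_subsets.subset ?_) ?_
  · rintro _ ⟨x, -, rfl⟩
    exact sep_subset _ _
  · intro x hx y hy hxy
    refine eq_of_active_eq hT hx hy.1 fun p hp hpx => ?_
    have : p ∈ {p ∈ T | p.1 x = p.2} := ⟨hp, hpx⟩
    exact ((Set.ext_iff.1 hxy p).1 this).2

/-- The halfspaces of finitely many translates: if no translate of the family `a` lies in the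
interior of `K`, this is witnessed by finitely many halfspaces containing `K`. -/
theorem exists_halfspaces_of_translates {ι : Type*} [Finite ι] {K : Set E} (hK : IsCompact K)
    (hconv : Convex ℝ K) (hint : (interior K).Nonempty) (a : ι → E)
    (ha : ∀ b, ∃ i, a i + b ∉ interior K) :
    ∃ (f : ι → StrongDual ℝ E) (c : ι → ℝ), (∀ i, ∀ x ∈ K, f i x ≤ c i) ∧
      ∀ b, ∃ i, f i ≠ 0 ∧ c i ≤ f i (a i + b) := by
  classical
  have := Fintype.ofFinite ι
  -- All translates of the family form an affine subspace of the product, which misses the open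
  -- convex set `(interior K)^ι`.
  let t : Set (ι → E) := {z | ∃ b, ∀ i, z i = a i + b}
  have htconv : Convex ℝ t := by
    rintro x ⟨b, hb⟩ y ⟨b', hb'⟩ r s - - hrs
    refine ⟨r • b + s • b', fun i => ?_⟩
    simp only [Pi.add_apply, Pi.smul_apply, hb i, hb' i]
    calc r • (a i + b) + s • (a i + b') = (r + s) • a i + (r • b + s • b') := by module
      _ = a i + (r • b + s • b') := by rw [hrs, one_smul]
  have hdisj : Disjoint (univ.pi fun _ : ι => interior K) t := by
    rw [Set.disjoint_left]
    rintro z hz ⟨b, hb⟩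
    obtain ⟨i, hi⟩ := ha b
    exact hi (hb i ▸ hz i (mem_univ i))
  obtain ⟨F, u, hFs, hFt⟩ := geometric_hahn_banach_open
    (convex_pi fun i _ => hconv.interior) (isOpen_set_pi finite_univ fun i _ => isOpen_interior)
    htconv hdisj
  have hFt' : ∀ b, u ≤ F a + F (fun _ => b) := fun b => by
    rw [← map_add]
    exact hFt _ ⟨b, fun i => rfl⟩
  have hF0 : ∀ b, F (fun _ => b) = 0 := by
    intro b
    by_contra hne
    -- The multiple of `b` is chosen so that `F` takes the value `u - 1` on the translated family,
    -- below the bound `u`.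
    have h := hFt' (((u - F a - 1) / F (fun _ => b)) • b)
    have h2 : F (fun _ => ((u - F a - 1) / F (fun _ => b)) • b) = u - F a - 1 := by
      have := map_smul F ((u - F a - 1) / F (fun _ => b)) (fun _ => b)
      rw [smul_eq_mul, div_mul_cancel₀ _ hne] at this
      exact this
    rw [h2] at h
    linarith
  have hua : u ≤ F a := by simpa [hF0] using hFt' 0
  let f : ι → StrongDual ℝ E := fun i => F.comp (ContinuousLinearMap.single ℝ (fun _ => E) i)
  have hFf : ∀ z, F z = ∑ i, f i (z i) := fun z => by
    conv_lhs => rw [← Finset.univ_sum_single z]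
    rw [map_sum]
    rfl
  have hKne : K.Nonempty := hint.mono interior_subset
  have hmax : ∀ i, ∃ x ∈ K, ∀ y ∈ K, f i y ≤ f i x := fun i =>
    hK.exists_isMaxOn hKne (f i).continuous.continuousOn
  choose x hxK hx using hmax
  have hxu : F x ≤ u := by
    have hmem : x ∈ closure (univ.pi fun _ : ι => interior K) := by
      rw [closure_pi_set, hconv.closure_interior_eq_closure_of_nonempty_interior hint]
      exact fun i _ => subset_closure (hxK i)
    exact closure_minimal (fun z hz => (hFs z hz).le)
      (isClosed_le F.continuous continuous_const) hmem
  refine ⟨f, fun i => f i (x i), fun i y hy => hx i y hy, fun b => ?_⟩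
  by_contra! hcon
  have hle : ∀ i, f i (a i + b) ≤ f i (x i) := fun i => by
    by_cases h : f i = 0
    · simp [h]
    · exact (hcon i h).le
  -- The sum on the right does not depend on `b`, since `F` vanishes on the diagonal. Hence not all
  -- terms can stay below the maxima of the `f i` on `K`.
  have hsum : ∑ i, f i (x i) ≤ ∑ i, f i (a i + b) := by
    rw [← hFf, ← hFf fun i => a i + b]
    have : F (fun i => a i + b) = F a + F fun _ => b := map_add F a fun _ => b
    rw [this, hF0]
    linarith
  have hzero : ∀ i, f i = 0 := by
    intro i
    by_contra h
    exact (Finset.sum_lt_sum (fun i _ => hle i) ⟨i, Finset.mem_univ i, hcon i h⟩).not_ge hsum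
  obtain ⟨w, hw⟩ := hint
  have h1 := hFs (fun _ => w) fun i _ => hw
  rw [hF0] at h1
  have h2 : F a = 0 := by simp [hFf, hzero]
  linarith

end Polyhedra

/-! ### Maximal free bodies: cuts and thickenings -/

section Copies

variable {d : ℕ}

theorem isPolytope_polyhedron {T : Set (StrongDual ℝ (EuclideanSpace ℝ (Fin d)) × ℝ)}
    (hT : T.Finite) (hne : (polyhedron T).Nonempty)
    (hb : Bornology.IsBounded (polyhedron T)) : IsPolytope (polyhedron T) := by
  have hcomp : IsCompact (polyhedron T) :=
    Metric.isCompact_of_isClosed_isBounded (isClosed_polyhedron T) hb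
  have hfin := finite_extremePoints_polyhedron hT
  refine ⟨_, hfin, hcomp.extremePoints_nonempty hne, ?_⟩
  rw [← (hfin.isClosed_convexHull (𝕜 := ℝ)).closure_eq]
  exact (closure_convexHull_extremePoints hcomp (convex_polyhedron T)).symm

/-- The inequalities `|x i| ≤ R`. -/
noncomputable def boxConstraints (d : ℕ) (R : ℝ) :
    Set (StrongDual ℝ (EuclideanSpace ℝ (Fin d)) × ℝ) :=
  range (fun i => (EuclideanSpace.proj i, R)) ∪ range fun i => (-EuclideanSpace.proj i, R)

theorem mem_polyhedron_boxConstraints {R : ℝ} {x : EuclideanSpace ℝ (Fin d)} :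
    x ∈ polyhedron (boxConstraints d R) ↔ ∀ i, |x i| ≤ R := by
  simp only [polyhedron, boxConstraints, abs_le', mem_union, or_imp, forall_and, forall_mem_range,
    mem_ofPred_eq]
  rfl

theorem isBounded_box (d : ℕ) (R : ℝ) :
    Bornology.IsBounded {x : EuclideanSpace ℝ (Fin d) | ∀ i, |x i| ≤ R} := by
  refine (Metric.isBounded_iff_subset_closedBall 0).2 ⟨√(∑ _ : Fin d, R ^ 2), fun x hx => ?_⟩
  rw [mem_closedBall_zero_iff, EuclideanSpace.norm_eq]
  gcongr with i
  exact hx i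

theorem exists_subset_box {K : Set (EuclideanSpace ℝ (Fin d))} (hK : Bornology.IsBounded K) :
    ∃ R : ℝ, ∀ x ∈ K, ∀ i, |x i| ≤ R := by
  obtain ⟨R, hR⟩ := hK.exists_norm_le
  exact ⟨R, fun x hx i => (PiLp.norm_apply_le x i).trans (hR x hx)⟩

theorem IsFree.nonempty_of_isUnimodularCopy {A : Subring ℝ}
    {X K Y : Set (EuclideanSpace ℝ (Fin d))} (hK : IsFree A X K) (hY : IsUnimodularCopy A X Y) :
    Y.Nonempty := by
  by_contra h
  rw [not_nonempty_iff_eq_empty] at h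
  exact hK Y hY (h ▸ empty_subset _)

/-- If every copy in a bounded region is cut off by one of finitely many halfspaces, then a
maximal free body with interior is a polytope. -/
theorem IsInclusionMaximalFree.isPolytope {A : Subring ℝ} {X K : Set (EuclideanSpace ℝ (Fin d))}
    (hK : IsInclusionMaximalFree A X K) (hint : (interior K).Nonempty)
    (hcut : ∀ Q : Set (EuclideanSpace ℝ (Fin d)), Bornology.IsBounded Q →
      ∃ T : Set (StrongDual ℝ (EuclideanSpace ℝ (Fin d)) × ℝ), T.Finite ∧ K ⊆ polyhedron T ∧
        ∀ Y, IsUnimodularCopy A X Y → Y ⊆ Q →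
          ∃ p ∈ T, p.1 ≠ 0 ∧ ∃ y ∈ Y, p.2 ≤ p.1 y) :
    IsPolytope K := by
  obtain ⟨⟨⟨hne, hcomp, -⟩, -⟩, hmax⟩ := hK
  obtain ⟨R, hR⟩ := exists_subset_box hcomp.isBounded
  obtain ⟨T, hT, hKT, hcut⟩ := hcut _ (isBounded_box d R)
  set T' := T ∪ boxConstraints d R with hT'
  have hfin : T'.Finite := hT.union ((finite_range _).union (finite_range _))
  have hpoly : polyhedron T' ⊆ {x | ∀ i, |x i| ≤ R} := fun x hx =>
    mem_polyhedron_boxConstraints.1 fun p hp => hx p (Or.inr hp)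
  have hKP : K ⊆ polyhedron T' := by
    rintro x hx p (hp | hp)
    · exact hKT hx p hp
    · exact mem_polyhedron_boxConstraints.2 (hR x hx) p hp
  have hb : Bornology.IsBounded (polyhedron T') := (isBounded_box d R).subset hpoly
  have hP : IsPolytope (polyhedron T') := isPolytope_polyhedron hfin (hne.mono hKP) hb
  have hfree : IsFree A X (polyhedron T') := by
    intro Y hY hsub
    obtain ⟨p, hp, hp0, y, hy, hpy⟩ :=
      hcut Y hY ((hsub.trans intrinsicInterior_subset).trans hpoly)
    -- An interior point of `K` satisfies the cut strictly, so the cut is strict on the whole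
    -- relative interior of the polyhedron.
    obtain ⟨w, hw⟩ := hint
    have hlt := lt_of_mem_intrinsicInterior (f := p.1) (c := p.2)
      (fun x (hx : x ∈ polyhedron T') => hx p (Or.inl hp)) (hsub hy) (hKP (interior_subset hw))
      (lt_of_mem_interior hp0 (fun x hx => hKT hx p hp) hw)
    exact hlt.not_ge hpy
  rwa [← hmax _ ⟨hne.mono hKP, Metric.isCompact_of_isClosed_isBounded (isClosed_polyhedron _) hb,
    convex_polyhedron _⟩ hfree hKP]

/-- A maximal free body in a hyperplane `f = c` has copies on one side of that hyperplane that come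
arbitrarily close to it. -/
theorem IsInclusionMaximalFree.exists_copies_of_affineSpan_ne_top {A : Subring ℝ}
    {X K : Set (EuclideanSpace ℝ (Fin d))}
    (hK : IsInclusionMaximalFree A X K) (hspan : affineSpan ℝ K ≠ ⊤) :
    ∃ f : StrongDual ℝ (EuclideanSpace ℝ (Fin d)), f ≠ 0 ∧ ∃ c : ℝ,
      ∃ Q : Set (EuclideanSpace ℝ (Fin d)), Bornology.IsBounded Q ∧
      ∃ Y : ℕ → Set (EuclideanSpace ℝ (Fin d)), ∀ n, IsUnimodularCopy A X (Y n) ∧ Y n ⊆ Q ∧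
        ∀ y ∈ Y n, c < f y ∧ f y ≤ c + 1 / ((n : ℝ) + 1) := by
  obtain ⟨⟨⟨⟨k, hk⟩, hcomp, hconv⟩, -⟩, hmax⟩ := hK
  have hdir : (affineSpan ℝ K).direction ≠ ⊤ := fun h =>
    hspan ((AffineSubspace.direction_eq_top_iff_of_nonempty ⟨k, subset_affineSpan ℝ K hk⟩).1 h)
  obtain ⟨f₀, hf₀, hker⟩ := Submodule.exists_le_ker_of_lt_top _ hdir.lt_top
  set f : StrongDual ℝ (EuclideanSpace ℝ (Fin d)) := LinearMap.toContinuousLinearMap f₀ with hfdef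
  have hf : f ≠ 0 := fun h => hf₀ (by simpa [hfdef] using h)
  have hfK : ∀ x ∈ K, f x = f k := fun x hx => by
    have : x - k ∈ LinearMap.ker f₀ := hker (AffineSubspace.vsub_mem_direction
      (subset_affineSpan ℝ K hx) (subset_affineSpan ℝ K hk))
    rw [LinearMap.mem_ker, map_sub, sub_eq_zero] at this
    exact this
  obtain ⟨v, hv⟩ : ∃ v, f v = 1 := by
    obtain ⟨w, hw⟩ := DFunLike.ne_iff.1 hf
    exact ⟨(f w)⁻¹ • w, by simpa using inv_mul_cancel₀ hw⟩
  let g : EuclideanSpace ℝ (Fin d) × ℝ →L[ℝ] EuclideanSpace ℝ (Fin d) :=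
    ContinuousLinearMap.fst ℝ _ _ + (ContinuousLinearMap.snd ℝ _ _).smulRight v
  have hg : ∀ x t, g (x, t) = x + t • v := fun x t => rfl
  -- `K` thickened to one side along `v`; as `f v = 1`, the values of `f` fill exactly `[f k, f k +
  -- ε]`.
  let C : ℝ → Set (EuclideanSpace ℝ (Fin d)) := fun ε => g '' (K ×ˢ Icc 0 ε)
  have hCcomp : ∀ ε, IsCompact (C ε) := fun ε => (hcomp.prod isCompact_Icc).image g.continuous
  have hCconv : ∀ ε, Convex ℝ (C ε) := fun ε =>
    (hconv.prod (convex_Icc 0 ε)).linear_image g.toLinearMap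
  have hKC : ∀ ε, 0 ≤ ε → K ⊆ C ε := fun ε hε x hx =>
    ⟨(x, 0), ⟨hx, by simp [hε]⟩, by simp [hg]⟩
  have hpt : ∀ ε, 0 ≤ ε → k + ε • v ∈ C ε := fun ε hε => ⟨(k, ε), ⟨hk, by simp [hε]⟩, rfl⟩
  have hfC : ∀ ε, ∀ x ∈ C ε, f k ≤ f x ∧ f x ≤ f k + ε := by
    rintro ε _ ⟨⟨x, t⟩, ⟨hx, ht⟩, rfl⟩
    simp only [hg, map_add, map_smul, hv, smul_eq_mul, mul_one, hfK x hx]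
    exact ⟨by linarith [ht.1], by linarith [ht.2]⟩
  have hnot : ∀ n : ℕ, ∃ Y, IsUnimodularCopy A X Y ∧
      Y ⊆ intrinsicInterior ℝ (C (1 / ((n : ℝ) + 1))) := by
    intro n
    have hε : (0 : ℝ) < 1 / ((n : ℝ) + 1) := by positivity
    by_contra! hcon
    have heq := hmax _ ⟨⟨k, hKC _ hε.le hk⟩, hCcomp _, hCconv _⟩ hcon (hKC _ hε.le)
    have h1 := hfK _ (heq ▸ hpt _ hε.le)
    rw [map_add, map_smul, hv, smul_eq_mul, mul_one] at h1
    linarith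
  choose Y hY hYC using hnot
  refine ⟨f, hf, f k, C 1, (hCcomp 1).isBounded, Y, fun n => ⟨hY n, ?_, fun y hy => ⟨?_, ?_⟩⟩⟩
  · refine ((hYC n).trans intrinsicInterior_subset).trans (image_mono (prod_mono_right ?_))
    refine Icc_subset_Icc_right ?_
    rw [div_le_one (by positivity)]
    linarith [n.cast_nonneg (α := ℝ)]
  · have hε : (0 : ℝ) < 1 / ((n : ℝ) + 1) := by positivity
    have := lt_of_mem_intrinsicInterior (f := -f) (c := -f k)
      (fun x hx => neg_le_neg (hfC _ x hx).1) (hYC n hy) (hpt _ hε.le)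
      (by simp only [neg_apply, map_add, map_smul, hv, smul_eq_mul]; linarith)
    simpa using this
  · exact (hfC _ y (intrinsicInterior_subset (hYC n hy))).2

/-! ### Finiteness in bounded regions -/

/-- The affine map `x ↦ M x + b` as a bundled map. -/
noncomputable def affineMapHom (M : Matrix.GeneralLinearGroup (Fin d) ℤ)
    (b : EuclideanSpace ℝ (Fin d)) :
    EuclideanSpace ℝ (Fin d) →ᵃ[ℝ] EuclideanSpace ℝ (Fin d) :=
  (Matrix.toEuclideanLin ((M : Matrix (Fin d) (Fin d) ℤ).map (Int.cast : ℤ → ℝ))).toAffineMap +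
    AffineMap.const ℝ _ b

theorem affineMapHom_apply (M : Matrix.GeneralLinearGroup (Fin d) ℤ)
    (b x : EuclideanSpace ℝ (Fin d)) : affineMapHom M b x = affineMap M b x := by
  ext i
  simp [affineMapHom, affineMap, Matrix.mulVec, dotProduct]

theorem affineMap_apply (M : Matrix.GeneralLinearGroup (Fin d) ℤ)
    (b x : EuclideanSpace ℝ (Fin d)) (i : Fin d) :
    affineMap M b x i = (∑ j, ((M : Matrix (Fin d) (Fin d) ℤ) i j : ℝ) * x j) + b i := rfl

theorem affineMap_eq_add (M : Matrix.GeneralLinearGroup (Fin d) ℤ)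
    (b x : EuclideanSpace ℝ (Fin d)) : affineMap M b x = affineMap M 0 x + b := by
  ext i
  simp [affineMap_apply]

/-- Affine maps sending `X` into a bounded set are uniformly bounded at each point of its affine
hull. -/
theorem exists_norm_le_of_mem_affineSpan {X Q : Set (EuclideanSpace ℝ (Fin d))}
    (hQ : Bornology.IsBounded Q) {q : EuclideanSpace ℝ (Fin d)} (hq : q ∈ affineSpan ℝ X) :
    ∃ C : ℝ, ∀ g : EuclideanSpace ℝ (Fin d) →ᵃ[ℝ] EuclideanSpace ℝ (Fin d),
      g '' X ⊆ Q → ‖g q‖ ≤ C := by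
  refine affineSpan_induction hq (fun x hx => ?_) fun c u v w hu hv hw => ?_
  · obtain ⟨C, hC⟩ := hQ.exists_norm_le
    exact ⟨C, fun g hg => hC _ (hg (mem_image_of_mem g hx))⟩
  · obtain ⟨Cu, hu⟩ := hu
    obtain ⟨Cv, hv⟩ := hv
    obtain ⟨Cw, hw⟩ := hw
    refine ⟨|c| * (Cu + Cv) + Cw, fun g hg => ?_⟩
    have : g (c • (u -ᵥ v) +ᵥ w) = c • (g u - g v) + g w := by
      rw [AffineMap.map_vadd, map_smul, AffineMap.linearMap_vsub]
      rfl
    rw [this]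
    calc ‖c • (g u - g v) + g w‖ ≤ ‖c • (g u - g v)‖ + ‖g w‖ := norm_add_le _ _
      _ = |c| * ‖g u - g v‖ + ‖g w‖ := by rw [norm_smul, Real.norm_eq_abs]
      _ ≤ |c| * (Cu + Cv) + Cw := by
        gcongr
        · exact (norm_sub_le _ _).trans (add_le_add (hu g hg) (hv g hg))
        · exact hw g hg

theorem finite_setOf_abs_le (C : ℝ) : {z : ℤ | |(z : ℝ)| ≤ C}.Finite := by
  refine (finite_Icc (-⌈C⌉) ⌈C⌉).subset fun z hz => ?_
  have h := abs_le.1 (show |(z : ℝ)| ≤ C from hz)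
  have h2 := Int.le_ceil C
  constructor
  · have : (-(⌈C⌉ : ℝ)) ≤ z := by linarith
    exact_mod_cast this
  · have : (z : ℝ) ≤ ⌈C⌉ := by linarith
    exact_mod_cast this

/-- Only finitely many unimodular matrices have a translate mapping a full-dimensional set into a
given bounded set. -/
theorem finite_setOf_image_subset {X Q : Set (EuclideanSpace ℝ (Fin d))}
    (hX : IsFullDimensional X) (hQ : Bornology.IsBounded Q) :
    {M : Matrix.GeneralLinearGroup (Fin d) ℤ | ∃ b, affineMap M b '' X ⊆ Q}.Finite := by
  have hbd : ∀ q, ∃ C : ℝ, ∀ g : EuclideanSpace ℝ (Fin d) →ᵃ[ℝ] EuclideanSpace ℝ (Fin d),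
      g '' X ⊆ Q → ‖g q‖ ≤ C := fun q =>
    exists_norm_le_of_mem_affineSpan hQ (by rw [show affineSpan ℝ X = ⊤ from hX]; trivial)
  choose C hC using hbd
  have hfin : {N : Fin d → Fin d → ℤ |
      ∀ i, N i ∈ {r : Fin d → ℤ | ∀ j, r j ∈ {z : ℤ | |(z : ℝ)| ≤
        C (EuclideanSpace.single j 1) + C 0}}}.Finite :=
    Set.Finite.pi' fun i => Set.Finite.pi' fun j => finite_setOf_abs_le _
  refine Set.Finite.of_finite_image (f := fun M i j => (M : Matrix (Fin d) (Fin d) ℤ) i j)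
    (hfin.subset ?_) ?_
  · rintro _ ⟨M, ⟨b, hb⟩, rfl⟩ i j
    have hb' : affineMapHom M b '' X ⊆ Q := by
      simpa only [affineMapHom_apply] using hb
    -- The entry `M i j` is the `i`-th coordinate of the image of the basis vector `e_j` minus that
    -- of the image of `0`; the translation cancels.
    have h1 := (PiLp.norm_apply_le _ i).trans (hC (EuclideanSpace.single j 1) _ hb')
    have h2 := (PiLp.norm_apply_le _ i).trans (hC 0 _ hb')
    rw [affineMapHom_apply, affineMap_apply] at h1 h2
    simp only [PiLp.single_apply, mul_ite, mul_one, mul_zero, Finset.sum_ite_eq',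
      Finset.mem_univ, if_true, PiLp.zero_apply, Finset.sum_const_zero, zero_add,
      Real.norm_eq_abs] at h1 h2
    change |(((M : Matrix (Fin d) (Fin d) ℤ) i j : ℤ) : ℝ)| ≤ _
    have h3 := abs_sub (((M : Matrix (Fin d) (Fin d) ℤ) i j : ℝ) + b i) (b i)
    rw [add_sub_cancel_right] at h3
    linarith
  · intro M _ M' _ h
    refine Units.ext ?_
    ext i j
    exact congrFun (congrFun h i) j

theorem finite_setOf_norm_le_of_denominator (N : ℕ) (hN : N ≠ 0) (C : ℝ) :
    {x : EuclideanSpace ℝ (Fin d) | ‖x‖ ≤ C ∧ ∀ i, ∃ z : ℤ, (N : ℝ) * x i = z}.Finite := by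
  have hN' : (N : ℝ) ≠ 0 := Nat.cast_ne_zero.2 hN
  have hfin : {r : Fin d → ℤ | ∀ j, r j ∈ {z : ℤ | |(z : ℝ)| ≤ N * C}}.Finite :=
    Set.Finite.pi' fun j => finite_setOf_abs_le _
  refine (hfin.image fun r => (WithLp.toLp 2 fun i => (r i : ℝ) / N :
    EuclideanSpace ℝ (Fin d))).subset ?_
  rintro x ⟨hx, hz⟩
  choose r hr using hz
  refine ⟨r, fun j => ?_, ?_⟩
  · change |(r j : ℝ)| ≤ N * C
    rw [← hr, abs_mul, Nat.abs_cast]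
    gcongr
    exact (PiLp.norm_apply_le x j).trans hx
  · ext i
    simp only [← hr]
    field_simp

theorem exists_denominator {q : EuclideanSpace ℝ (Fin d)} (hq : q ∈ rationalPoints d) :
    ∃ N : ℕ, N ≠ 0 ∧ ∀ i, ∃ z : ℤ, (N : ℝ) * q i = z := by
  choose r hr using hq
  refine ⟨∏ i, (r i).den, Finset.prod_ne_zero_iff.2 fun i _ => (r i).den_ne_zero, fun i => ?_⟩
  obtain ⟨m, hm⟩ := Finset.dvd_prod_of_mem (fun i => (r i).den) (Finset.mem_univ i)
  refine ⟨m * (r i).num, ?_⟩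
  have h : ((r i).den : ℝ) * (r i : ℝ) = (r i).num := by
    exact_mod_cast Rat.den_mul_eq_num (r i)
  rw [hm, hr]
  push_cast
  rw [← h]
  ring

/-- Only finitely many integer unimodular copies of a set with rational affine hull lie in a
given bounded set. -/
theorem finite_setOf_isUnimodularCopy_subset {X Q : Set (EuclideanSpace ℝ (Fin d))}
    (hX : HasRationalAffineHull X) (hQ : Bornology.IsBounded Q) :
    {Y | IsUnimodularCopy intRing X Y ∧ Y ⊆ Q}.Finite := by
  -- A finite set `t` of rational points spanning the affine hull: a copy is determined by the
  -- images of `t`, which are bounded and keep the denominators of `t`.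
  obtain ⟨t, hts, htspan, htind⟩ :=
    exists_affineIndependent ℝ _
      (rationalPoints d ∩ (affineSpan ℝ X : Set (EuclideanSpace ℝ (Fin d))))
  have htfin : Finite t := finite_of_fin_dim_affineIndependent ℝ htind
  replace htspan : affineSpan ℝ t = affineSpan ℝ X := htspan.trans hX
  have hC : ∀ q : t, ∃ C : ℝ,
      ∀ g : EuclideanSpace ℝ (Fin d) →ᵃ[ℝ] EuclideanSpace ℝ (Fin d),
        g '' X ⊆ Q → ‖g q‖ ≤ C := fun q => exists_norm_le_of_mem_affineSpan hQ (hts q.2).2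
  choose C hC using hC
  have hN : ∀ q : t, ∃ N : ℕ, N ≠ 0 ∧ ∀ i, ∃ z : ℤ,
      (N : ℝ) * (q : EuclideanSpace ℝ (Fin d)) i = z :=
    fun q => exists_denominator (hts q.2).1
  choose N hN0 hN using hN
  have hfin : {h : t → EuclideanSpace ℝ (Fin d) | ∀ q, h q ∈ {x : EuclideanSpace ℝ (Fin d) |
      ‖x‖ ≤ C q ∧ ∀ i, ∃ z : ℤ, (N q : ℝ) * x i = z}}.Finite :=
    Set.Finite.pi' fun q => finite_setOf_norm_le_of_denominator (N q) (hN0 q) (C q)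
  have hex : ∀ Y ∈ {Y | IsUnimodularCopy intRing X Y ∧ Y ⊆ Q},
      ∃ h ∈ {h : t → EuclideanSpace ℝ (Fin d) | ∀ q, h q ∈ {x : EuclideanSpace ℝ (Fin d) |
        ‖x‖ ≤ C q ∧ ∀ i, ∃ z : ℤ, (N q : ℝ) * x i = z}},
      ∃ g : EuclideanSpace ℝ (Fin d) →ᵃ[ℝ] EuclideanSpace ℝ (Fin d),
        Y = g '' X ∧ ∀ q : t, g q = h q := by
    rintro Y ⟨⟨M, b, hb, rfl⟩, hYQ⟩
    have himg : affineMap M b '' X = affineMapHom M b '' X := by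
      simp only [affineMapHom_apply]
    refine ⟨fun q => affineMapHom M b q, fun q => ⟨hC q _ (himg ▸ hYQ), fun i => ?_⟩,
      affineMapHom M b, himg, fun q => rfl⟩
    choose z hz using hN q
    obtain ⟨c, hc⟩ := hb i
    have hc : (c : ℝ) = b i := hc
    refine ⟨∑ j, (M : Matrix (Fin d) (Fin d) ℤ) i j * z j + N q * c, ?_⟩
    change (N q : ℝ) * (affineMapHom M b q) i = _
    rw [affineMapHom_apply, affineMap_apply, mul_add, Finset.mul_sum, ← hc]
    push_cast
    congr 1
    refine Finset.sum_congr rfl fun j _ => ?_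
    rw [← hz]
    ring
  choose! h hmem g hg hgh using hex
  refine Set.Finite.of_finite_image (f := h) (hfin.subset ?_) ?_
  · rintro _ ⟨Y, hY, rfl⟩
    exact hmem Y hY
  · intro Y hY Y' hY' heq
    rw [hg Y hY, hg Y' hY']
    have hagree : EqOn (g Y) (g Y') t := fun q hq => by
      rw [hgh Y hY ⟨q, hq⟩, hgh Y' hY' ⟨q, hq⟩, heq]
    refine image_congr fun x hx => AffineMap.eqOn_affineSpan hagree ?_
    rw [htspan]
    exact subset_affineSpan ℝ X hx

/-! ### Integer translations -/

theorem IsInclusionMaximalFree.isPolytope_of_hasRationalAffineHull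
    {X K : Set (EuclideanSpace ℝ (Fin d))} (hX : HasRationalAffineHull X)
    (hK : IsInclusionMaximalFree intRing X K) : IsPolytope K := by
  have hint : (interior K).Nonempty := by
    rw [hK.1.1.2.2.interior_nonempty_iff_affineSpan_eq_top]
    by_contra hspan
    obtain ⟨f, -, c, Q, hQ, Y, hY⟩ := hK.exists_copies_of_affineSpan_ne_top hspan
    have hfin := finite_setOf_isUnimodularCopy_subset hX hQ
    have : Finite {Y | IsUnimodularCopy intRing X Y ∧ Y ⊆ Q} := hfin
    obtain ⟨⟨Z, hZ⟩, hinf⟩ := Finite.exists_infinite_fiber fun n =>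
      (⟨Y n, (hY n).1, (hY n).2.1⟩ : {Y | IsUnimodularCopy intRing X Y ∧ Y ⊆ Q})
    obtain ⟨y, hy⟩ := hK.1.2.nonempty_of_isUnimodularCopy hZ.1
    have hlt : c < f y := by
      obtain ⟨n, hn⟩ := hinf.nonempty
      have hn : Y n = Z := congrArg Subtype.val hn
      exact ((hY n).2.2 y (hn ▸ hy)).1
    obtain ⟨m, hm⟩ := exists_nat_one_div_lt (sub_pos.2 hlt)
    obtain ⟨n, hn, hmn⟩ := (infinite_coe_iff.1 hinf).exists_gt m
    have hn : Y n = Z := congrArg Subtype.val hn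
    have h1 := ((hY n).2.2 y (hn ▸ hy)).2
    have h2 : 1 / ((n : ℝ) + 1) ≤ 1 / ((m : ℝ) + 1) := by gcongr
    linarith
  refine hK.isPolytope hint fun Q hQ => ?_
  have hfin := finite_setOf_isUnimodularCopy_subset hX hQ
  have hsep : ∀ Y, IsUnimodularCopy intRing X Y →
      ∃ p : StrongDual ℝ (EuclideanSpace ℝ (Fin d)) × ℝ,
        (∀ x ∈ K, p.1 x ≤ p.2) ∧ p.1 ≠ 0 ∧ ∃ y ∈ Y, p.2 ≤ p.1 y := by
    intro Y hY
    obtain ⟨y, hy, hyK⟩ := not_subset.1 fun h =>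
      hK.1.2 Y hY (h.trans interior_subset_intrinsicInterior)
    obtain ⟨f, hf⟩ := geometric_hahn_banach_open_point hK.1.1.2.2.interior isOpen_interior hyK
    refine ⟨(f, f y), fun x hx => ?_, ?_, y, hy, le_rfl⟩
    · have hmem : x ∈ closure (interior K) := by
        rw [hK.1.1.2.2.closure_interior_eq_closure_of_nonempty_interior hint]
        exact subset_closure hx
      exact closure_minimal (fun z hz => (hf z hz).le)
        (isClosed_le f.continuous continuous_const) hmem
    · rintro rfl
      obtain ⟨w, hw⟩ := hint
      exact lt_irrefl _ (hf w hw)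
  choose! p hpK hp0 hpY using hsep
  refine ⟨_, hfin.image p, ?_, fun Y hY hYQ => ⟨p Y, ⟨Y, ⟨hY, hYQ⟩, rfl⟩, hp0 Y hY, hpY Y hY⟩⟩
  rintro x hx _ ⟨Y, hY, rfl⟩
  exact hpK Y hY.1 x hx

/-! ### Real translations -/

/-- Unimodular maps do not collapse full-dimensional sets onto a hyperplane. -/
theorem eq_zero_of_comp_affineMap_const {X : Set (EuclideanSpace ℝ (Fin d))}
    (hX : IsFullDimensional X) (M : Matrix.GeneralLinearGroup (Fin d) ℤ)
    (f : StrongDual ℝ (EuclideanSpace ℝ (Fin d))) (c : ℝ)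
    (h : ∀ x ∈ X, f (affineMap M 0 x) = c) : f = 0 := by
  have hall : ∀ x, f (affineMap M 0 x) = c := by
    intro x
    have hagree : EqOn (f.toLinearMap.toAffineMap.comp (affineMapHom M 0))
        (AffineMap.const ℝ _ c) X := fun x hx => by
      simpa [affineMapHom_apply] using h x hx
    have := AffineMap.eqOn_affineSpan hagree (x := x)
      (by rw [show affineSpan ℝ X = ⊤ from hX]; trivial)
    simpa [affineMapHom_apply] using this
  have hinv : ∀ y, affineMap M 0 (affineMap M⁻¹ 0 y) = y := by
    intro y
    ext i
    have hmul : ∀ k, ∑ j, (((M : Matrix (Fin d) (Fin d) ℤ) i j : ℝ) *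
        ((M⁻¹ : Matrix.GeneralLinearGroup (Fin d) ℤ) : Matrix (Fin d) (Fin d) ℤ) j k) =
        if i = k then 1 else 0 := by
      intro k
      have h1 : ((M : Matrix (Fin d) (Fin d) ℤ) *
          ((M⁻¹ : Matrix.GeneralLinearGroup (Fin d) ℤ) : Matrix (Fin d) (Fin d) ℤ)) i k =
          (1 : Matrix (Fin d) (Fin d) ℤ) i k := by
        rw [Units.mul_inv]
      rw [Matrix.mul_apply, Matrix.one_apply] at h1
      exact_mod_cast h1
    simp only [affineMap_apply, PiLp.zero_apply, add_zero, Finset.mul_sum, ← mul_assoc]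
    rw [Finset.sum_comm]
    simp only [← Finset.sum_mul, hmul]
    simp
  have hc : ∀ y, f y = c := fun y => hinv y ▸ hall _
  ext y
  rw [hc y, ← hc 0, map_zero]
  rfl

theorem IsInclusionMaximalFree.isPolytope_of_isPolytope
    {X K : Set (EuclideanSpace ℝ (Fin d))} (hX : IsPolytope X) (hfull : IsFullDimensional X)
    (hK : IsInclusionMaximalFree ⊤ X K) : IsPolytope K := by
  have hint : (interior K).Nonempty := by
    rw [hK.1.1.2.2.interior_nonempty_iff_affineSpan_eq_top]
    by_contra hspan
    obtain ⟨f, hf, c, Q, hQ, Y, hY⟩ := hK.exists_copies_of_affineSpan_ne_top hspan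
    have hfin := finite_setOf_image_subset hfull hQ
    choose M b _ hMb using fun n => (hY n).1
    have : Finite {M : Matrix.GeneralLinearGroup (Fin d) ℤ | ∃ b, affineMap M b '' X ⊆ Q} := hfin
    obtain ⟨⟨N, hN⟩, hinf⟩ := Finite.exists_infinite_fiber fun n =>
      (⟨M n, b n, hMb n ▸ (hY n).2.1⟩ :
        {M : Matrix.GeneralLinearGroup (Fin d) ℤ | ∃ b, affineMap M b '' X ⊆ Q})
    -- The width of `N X` along `f` is translation invariant and below `1/(n+1)` for infinitely many
    -- `n`, hence zero.
    have hle : ∀ x ∈ X, ∀ x' ∈ X, f (affineMap N 0 x) ≤ f (affineMap N 0 x') := by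
      intro x hx x' hx'
      by_contra! hlt
      obtain ⟨m, hm⟩ := exists_nat_one_div_lt (sub_pos.2 hlt)
      obtain ⟨n, hn, hmn⟩ := (infinite_coe_iff.1 hinf).exists_gt m
      have hn : M n = N := congrArg Subtype.val hn
      have h1 := ((hY n).2.2 (affineMap N (b n) x) (by rw [hMb, hn]; exact ⟨x, hx, rfl⟩)).2
      have h2 := ((hY n).2.2 (affineMap N (b n) x') (by rw [hMb, hn]; exact ⟨x', hx', rfl⟩)).1
      rw [affineMap_eq_add, map_add] at h1 h2
      have h3 : 1 / ((n : ℝ) + 1) ≤ 1 / ((m : ℝ) + 1) := by gcongr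
      linarith
    obtain ⟨x₀, hx₀⟩ : X.Nonempty := by
      obtain ⟨V, -, hV, rfl⟩ := hX
      exact convexHull_nonempty_iff.2 hV
    exact hf (eq_zero_of_comp_affineMap_const hfull N f (f (affineMap N 0 x₀))
      fun x hx => (hle x hx x₀ hx₀).antisymm (hle x₀ hx₀ x hx))
  refine hK.isPolytope hint fun Q hQ => ?_
  have hfin := finite_setOf_image_subset hfull hQ
  obtain ⟨V, hV, -, rfl⟩ := hX
  have : Finite V := hV
  -- By convexity of the interior, a copy escapes it only if the image of a point of `V` does.
  have hsep : ∀ M : Matrix.GeneralLinearGroup (Fin d) ℤ, ∀ b, ∃ v : V,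
      affineMap M 0 v + b ∉ interior K := by
    intro M b
    by_contra! hcon
    refine hK.1.2 _ ⟨M, b, fun i => trivial, rfl⟩ (Subset.trans ?_ interior_subset_intrinsicInterior)
    have himg : affineMap M b '' convexHull ℝ V = convexHull ℝ (affineMapHom M b '' V) := by
      rw [← AffineMap.image_convexHull]
      simp only [affineMapHom_apply]
    rw [himg]
    refine convexHull_min ?_ hK.1.1.2.2.interior
    rintro _ ⟨v, hv, rfl⟩
    rw [affineMapHom_apply, affineMap_eq_add]
    exact hcon ⟨v, hv⟩
  choose f c hfK hf using fun M : Matrix.GeneralLinearGroup (Fin d) ℤ =>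
    exists_halfspaces_of_translates hK.1.1.2.1 hK.1.1.2.2 hint
      (fun v : V => affineMap M 0 v) (hsep M)
  refine ⟨⋃ M ∈ {M : Matrix.GeneralLinearGroup (Fin d) ℤ |
      ∃ b, affineMap M b '' convexHull ℝ V ⊆ Q}, range fun v => (f M v, c M v), hfin.biUnion fun M _ => finite_range _, ?_, ?_⟩
  · intro x hx p hp
    obtain ⟨M, -, v, rfl⟩ := mem_iUnion₂.1 hp
    exact hfK M v x hx
  · rintro _ ⟨M, b, -, rfl⟩ hYQ
    obtain ⟨v, hv0, hv⟩ := hf M b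
    refine ⟨_, mem_iUnion₂.2 ⟨M, ⟨b, hYQ⟩, v, rfl⟩, hv0, _,
      ⟨v, subset_convexHull ℝ V v.2, rfl⟩, ?_⟩
    rw [affineMap_eq_add]
    exact hv

theorem affineSpan_rationalPoints : affineSpan ℝ (rationalPoints d) = ⊤ := by
  have h0 : (0 : EuclideanSpace ℝ (Fin d)) ∈ rationalPoints d := fun i => ⟨0, by simp⟩
  rw [AffineSubspace.affineSpan_eq_top_iff_vectorSpan_eq_top_of_nonempty ℝ _ _ ⟨0, h0⟩,
    ← top_le_iff, ← (EuclideanSpace.basisFun (Fin d) ℝ).toBasis.span_eq, Submodule.span_le]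
  rintro _ ⟨i, rfl⟩
  have hi : EuclideanSpace.single i (1 : ℝ) ∈ rationalPoints d := fun j =>
    ⟨if j = i then 1 else 0, by
      by_cases h : j = i <;> simp [h]⟩
  simpa using vsub_mem_vectorSpan ℝ hi h0

theorem IsFullDimensional.hasRationalAffineHull {X : Set (EuclideanSpace ℝ (Fin d))}
    (hX : IsFullDimensional X) : HasRationalAffineHull X := by
  rw [HasRationalAffineHull, show affineSpan ℝ X = ⊤ from hX, AffineSubspace.top_coe, inter_univ,
    affineSpan_rationalPoints]

end Copies

end UnimodularFree

theorem theorem1p2 (d : ℕ) :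
    (∀ A : Subring ℝ, (A = UnimodularFree.intRing ∨ A = ⊤) →
      ∀ X : Set (EuclideanSpace ℝ (Fin d)),
        UnimodularFree.IsPolytope X → UnimodularFree.IsFullDimensional X →
        ∀ K : Set (EuclideanSpace ℝ (Fin d)),
          UnimodularFree.IsInclusionMaximalFree A X K → UnimodularFree.IsPolytope K) ∧
    (∀ X : Set (EuclideanSpace ℝ (Fin d)),
      Bornology.IsBounded X → UnimodularFree.HasRationalAffineHull X →
        ∀ K : Set (EuclideanSpace ℝ (Fin d)),
          UnimodularFree.IsInclusionMaximalFree UnimodularFree.intRing X K →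
            UnimodularFree.IsPolytope K) := by
  refine ⟨?_, fun X _ hX K hK => hK.isPolytope_of_hasRationalAffineHull hX⟩
  rintro A (rfl | rfl) X hX hfull K hK
  · exact hK.isPolytope_of_hasRationalAffineHull hfull.hasRationalAffineHull
  · exact hK.isPolytope_of_isPolytope hX hfull
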